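/- **Lemma (semistability of Gauss maps).** Let $X$ be a Euclidean building or a symmetric space of noncompact type. Here a *Hadamard space* is a complete geodesic metric space of curvature $\le 0$ in the sense of global triangle comparison (a $CAT(0)$ space). A *Euclidean building* is a Hadamard space together with a maximal atlas of isometric embeddings (charts) $E\hookrightarrow X$, where $(E,W_{aff})$ is a Euclidean Coxeter complex (a finite-dimensional Euclidean space with a group of isometries $W_{aff}$ generated by hyperplane reflections and having finite linear part), such that coordinate changes between charts are restrictions of elements of $W_{aff}$ and any two points, any geodesic ray and any complete geodesic lie in the image of a chart. A *symmetric space of noncompact type* is a nonempty Riemannian symmetric space (every point is an isolated fixed point of an involutive isometry) which is complete, simply connected and of nonpositive curvature (that is, a Hadamard space), and which has no Euclidean factor, i.e. is not isometric to a product $\mathbb R\times Y$. Let $\partial_{Tits}X$ be the set of asymptoticity classes of geodesic rays in $X$, with the Tits angle $\angle_{Tits}\in[0,\pi]$ given by $$2\sin\frac{\angle_{Tits}(\xi_1,\xi_2)}2=\lim_{t\to\infty}\frac{d(\rho_1(t),\rho_2(t))}{t}$$ for unit speed rays $\rho_i$ asymptotic to $\xi_i$. Let $n\ge 1$, let $P=x_1\dots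 x_n$ be a polygon in $X$, i.e. a map $\mathbb Z/n\mathbb Z\to X$, $i\mapsto x_i$, put $m_i=d(x_{i-1},x_i)$, and let $\nu$ be the measure on $\mathbb Z/n\mathbb Z$ with $\nu(\{i\})=m_i$. Let $\psi:\mathbb Z/n\mathbb Z\to\partial_{Tits}X$, $i\mapsto\xi_i$, be any Gauss map of $P$, i.e. for every $i$ the geodesic ray from $x_{i-1}$ asymptotic to $\xi_i$ passes through $x_i$. Then the measure $\mu=\psi_*\nu=\sum_i m_i\delta_{\xi_i}$ on $\partial_{Tits}X$ is semistable: for all $\eta\in\partial_{Tits}X$, $$slope_\mu(\eta)=-\int\cos\angle_{Tits}(\xi,\eta)\,d\mu(\xi)=-\sum_{i\in\mathbb Z/n\mathbb Z}m_i\cos\angle_{Tits}(\xi_i,\eta)\ \ge\ 0 .$$ -/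

import Mathlib

open Filter Topology MeasureTheory
open scoped NNReal Manifold ContDiff Bundle

noncomputable section

universe u

/-! ### Hadamard spaces -/

/-- `σ`, restricted to `[0, 1]`, is a constant speed parametrization of a distance minimizing
geodesic segment from `x` to `y`. -/
def IsGeodesicSegment {X : Type*} [MetricSpace X] (σ : ℝ → X) (x y : X) : Prop :=
  σ 0 = x ∧ σ 1 = y ∧
    ∀ s ∈ Set.Icc (0 : ℝ) 1, ∀ t ∈ Set.Icc (0 : ℝ) 1, dist (σ s) (σ t) = |s - t| * dist x y

/-- A Hadamard space: a complete geodesic metric space in which every geodesic triangle is thinner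
than its comparison triangle in the Euclidean plane. Two points lying on two different sides
of a triangle are written as `α s` and `β t`, where `x` is the vertex shared by these sides. -/
structure IsHadamardSpace (X : Type*) [MetricSpace X] : Prop where
  complete : CompleteSpace X
  geodesic : ∀ x y : X, ∃ σ : ℝ → X, IsGeodesicSegment σ x y
  thin : ∀ (x y z : X) (α β : ℝ → X), IsGeodesicSegment α x y → IsGeodesicSegment β x z →
    ∀ x' y' z' : EuclideanSpace ℝ (Fin 2),
      dist x' y' = dist x y → dist x' z' = dist x z → dist y' z' = dist y z →
      ∀ s ∈ Set.Icc (0 : ℝ) 1, ∀ t ∈ Set.Icc (0 : ℝ) 1,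
        dist (α s) (β t) ≤ dist (AffineMap.lineMap x' y' s) (AffineMap.lineMap x' z' t)

/-! ### The boundary at infinity and the Tits angle -/

/-- A geodesic ray: an isometric embedding of `[0, ∞)`. -/
structure GeodesicRay (X : Type*) [MetricSpace X] where
  toFun : ℝ≥0 → X
  isometry : Isometry toFun

/-- Two rays are asymptotic if the distance between them is bounded. -/
def GeodesicRay.Asymptotic {X : Type*} [MetricSpace X] (ρ₁ ρ₂ : GeodesicRay X) : Prop :=
  ∃ C : ℝ, ∀ t : ℝ≥0, dist (ρ₁.toFun t) (ρ₂.toFun t) ≤ C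

/-- Asymptoticity as an equivalence relation on rays. -/
instance GeodesicRay.asymptoticSetoid (X : Type*) [MetricSpace X] : Setoid (GeodesicRay X) where
  r := GeodesicRay.Asymptotic
  iseqv := by
    refine ⟨fun ρ => ⟨0, fun t => by simp⟩, ?_, ?_⟩
    · rintro ρ₁ ρ₂ ⟨C, hC⟩
      exact ⟨C, fun t => by rw [dist_comm]; exact hC t⟩
    · rintro ρ₁ ρ₂ ρ₃ ⟨C, hC⟩ ⟨D, hD⟩
      exact ⟨C + D, fun t => (dist_triangle _ (ρ₂.toFun t) _).trans (add_le_add (hC t) (hD t))⟩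

/-- The boundary at infinity: asymptoticity classes of geodesic rays. -/
def IdealBoundary (X : Type*) [MetricSpace X] : Type _ :=
  Quotient (GeodesicRay.asymptoticSetoid X)

/-- The ideal point represented by a ray. -/
def GeodesicRay.endpoint {X : Type*} [MetricSpace X] (ρ : GeodesicRay X) : IdealBoundary X :=
  Quotient.mk (GeodesicRay.asymptoticSetoid X) ρ

/-- The linear rate of divergence `lim_{t → ∞} d(ρ₁(t), ρ₂(t)) / t` of two rays. -/
def GeodesicRay.divergence {X : Type*} [MetricSpace X] (ρ₁ ρ₂ : GeodesicRay X) : ℝ :=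
  limUnder atTop fun t : ℝ≥0 => dist (ρ₁.toFun t) (ρ₂.toFun t) / (t : ℝ)

theorem GeodesicRay.divergence_congr {X : Type*} [MetricSpace X] (ρ₁ ρ₂ ρ₁' ρ₂' : GeodesicRay X)
    (h₁ : ρ₁.Asymptotic ρ₁') (h₂ : ρ₂.Asymptotic ρ₂') :
    ρ₁.divergence ρ₂ = ρ₁'.divergence ρ₂' := by
  obtain ⟨C, hC⟩ := h₁
  obtain ⟨D, hD⟩ := h₂
  have hlim : Tendsto (fun t : ℝ≥0 => dist (ρ₁.toFun t) (ρ₂.toFun t) / (t : ℝ)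
      - dist (ρ₁'.toFun t) (ρ₂'.toFun t) / (t : ℝ)) atTop (𝓝 0) := by
    have hb : Tendsto (fun t : ℝ≥0 => (C + D) / (t : ℝ)) atTop (𝓝 0) :=
      Tendsto.div_atTop tendsto_const_nhds (NNReal.tendsto_coe_atTop.2 tendsto_id)
    refine squeeze_zero_norm (fun t => ?_) hb
    rw [← sub_div, Real.norm_eq_abs, abs_div, abs_of_nonneg (NNReal.coe_nonneg t)]
    refine div_le_div_of_nonneg_right ?_ t.2
    have := abs_dist_sub_le (ρ₁.toFun t) (ρ₁'.toFun t) (ρ₂.toFun t)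
    have h2 := abs_dist_sub_le (ρ₂.toFun t) (ρ₂'.toFun t) (ρ₁'.toFun t)
    rw [dist_comm (ρ₂.toFun t) (ρ₁'.toFun t), dist_comm (ρ₂'.toFun t) (ρ₁'.toFun t)] at h2
    have e1 := hC t
    have e2 := hD t
    rw [abs_le] at *
    constructor <;> linarith [this.1, this.2, h2.1, h2.2]
  have key : ∀ l : ℝ,
      Tendsto (fun t : ℝ≥0 => dist (ρ₁.toFun t) (ρ₂.toFun t) / (t : ℝ)) atTop (𝓝 l) ↔
      Tendsto (fun t : ℝ≥0 => dist (ρ₁'.toFun t) (ρ₂'.toFun t) / (t : ℝ)) atTop (𝓝 l) := by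
    intro l
    constructor
    · intro h
      simpa using h.sub hlim
    · intro h
      simpa using h.add hlim
  have hp : (fun l : ℝ =>
      map (fun t : ℝ≥0 => dist (ρ₁.toFun t) (ρ₂.toFun t) / (t : ℝ)) atTop ≤ 𝓝 l) =
      (fun l : ℝ =>
      map (fun t : ℝ≥0 => dist (ρ₁'.toFun t) (ρ₂'.toFun t) / (t : ℝ)) atTop ≤ 𝓝 l) :=
    funext fun l => propext (key l)
  unfold GeodesicRay.divergence limUnder lim
  rw [hp]

/-- The Tits angle, characterized by
`2 sin (∠(ξ₁, ξ₂) / 2) = lim_{t → ∞} d(ρ₁(t), ρ₂(t)) / t` and `0 ≤ ∠(ξ₁, ξ₂) ≤ π`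
for rays `ρ₁`, `ρ₂` representing `ξ₁`, `ξ₂`. In a Hadamard space this limit exists. -/
def titsAngle {X : Type*} [MetricSpace X] (ξ₁ ξ₂ : IdealBoundary X) : ℝ :=
  2 * Real.arcsin (Quotient.lift₂ GeodesicRay.divergence GeodesicRay.divergence_congr ξ₁ ξ₂ / 2)

/-! ### Euclidean buildings -/

/-- `g` is the reflection at a hyperplane of `ℝᵈ`. -/
def IsHyperplaneReflection {d : ℕ}
    (g : EuclideanSpace ℝ (Fin d) ≃ᵃⁱ[ℝ] EuclideanSpace ℝ (Fin d)) : Prop :=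
  ∃ (H : AffineSubspace ℝ (EuclideanSpace ℝ (Fin d))) (_ : Nonempty H),
    Module.finrank ℝ H.direction + 1 = d ∧ g = EuclideanGeometry.reflection H

/-- `(ℝᵈ, W)` is a Euclidean Coxeter complex: `W` is generated by reflections at hyperplanes, and
the group of linear parts of elements of `W` is finite. -/
structure IsEuclideanCoxeterComplex {d : ℕ}
    (W : Subgroup (EuclideanSpace ℝ (Fin d) ≃ᵃⁱ[ℝ] EuclideanSpace ℝ (Fin d))) : Prop where
  generated : Subgroup.closure {g | g ∈ W ∧ IsHyperplaneReflection g} = W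
  finite_linear : {r | ∃ g ∈ W, r = g.linearIsometryEquiv}.Finite

/-- A family of isometric embeddings `ℝᵈ → X` whose coordinate changes are restrictions of
elements of `W`. -/
structure IsApartmentAtlas {d : ℕ}
    (W : Subgroup (EuclideanSpace ℝ (Fin d) ≃ᵃⁱ[ℝ] EuclideanSpace ℝ (Fin d)))
    {X : Type*} [MetricSpace X] (A : Set (EuclideanSpace ℝ (Fin d) → X)) : Prop where
  isometry : ∀ f ∈ A, Isometry f
  coord_change : ∀ f ∈ A, ∀ g ∈ A, ∃ w ∈ W, ∀ p q, f p = g q → q = w p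

/-- `X` is a Euclidean building, modelled on some Euclidean Coxeter complex `(ℝᵈ, W)`, with
maximal atlas `A`. The apartments are the images of the charts in `A`. -/
def IsEuclideanBuilding (X : Type*) [MetricSpace X] : Prop :=
  IsHadamardSpace X ∧
  ∃ (d : ℕ) (W : Subgroup (EuclideanSpace ℝ (Fin d) ≃ᵃⁱ[ℝ] EuclideanSpace ℝ (Fin d)))
    (A : Set (EuclideanSpace ℝ (Fin d) → X)),
    IsEuclideanCoxeterComplex W ∧
    IsApartmentAtlas W A ∧
    (∀ A', IsApartmentAtlas W A' → A ⊆ A' → A' = A) ∧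
    (∀ x y : X, ∃ f ∈ A, x ∈ Set.range f ∧ y ∈ Set.range f) ∧
    (∀ ρ : GeodesicRay X, ∃ f ∈ A, Set.range ρ.toFun ⊆ Set.range f) ∧
    (∀ γ : ℝ → X, Isometry γ → ∃ f ∈ A, Set.range γ ⊆ Set.range f)

/-! ### Symmetric spaces of noncompact type -/

/-- The metric of `X` is the distance of some finite-dimensional smooth Riemannian manifold
structure on `X`. -/
def IsSmoothRiemannian (X : Type*) [MetricSpace X] : Prop :=
  ∃ (d : ℕ) (_ : ChartedSpace (EuclideanSpace ℝ (Fin d)) X)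
    (_ : IsManifold (𝓡 d) ∞ X)
    (_ : Bundle.RiemannianBundle (fun x : X => TangentSpace (𝓡 d) x)),
    IsContMDiffRiemannianBundle (𝓡 d) ∞ (EuclideanSpace ℝ (Fin d))
      (fun x : X => TangentSpace (𝓡 d) x) ∧
    IsRiemannianManifold (𝓡 d) X

/-- A symmetric space of noncompact type: a Riemannian manifold in which every point is an isolated
fixed point of an involutive isometry, which is complete, simply connected and of nonpositive
curvature in the (global) sense of triangle comparison, i.e. a Hadamard space, and
which has no Euclidean factor, i.e. does not split isometrically as an `ℓ²`-product `ℝ × Y`. -/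
structure IsSymmetricSpaceOfNoncompactType (X : Type u) [MetricSpace X] : Prop where
  nonempty : Nonempty X
  riemannian : IsSmoothRiemannian X
  symmetric : ∀ p : X, ∃ s : X ≃ᵢ X, s p = p ∧ (∀ q, s (s q) = q) ∧ ∀ᶠ q in 𝓝[≠] p, s q ≠ q
  nonpos_curved : IsHadamardSpace X
  no_euclidean_factor : ∀ (Y : Type u) [MetricSpace Y], IsEmpty (X ≃ᵢ WithLp 2 (ℝ × Y))

/-! ### Measures at infinity, stability and Gauss maps -/

/-- The measures on the boundary considered here are finitely supported, hence defined on all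
subsets. -/
instance IdealBoundary.instMeasurableSpace (X : Type*) [MetricSpace X] :
    MeasurableSpace (IdealBoundary X) := ⊤

/-- The slope function `slope_μ(η) = -∫ cos ∠(ξ, η) dμ(ξ)`; for `μ = ∑ mᵢ δ_{ξᵢ}` this is
`-∑ mᵢ cos ∠(ξᵢ, η)`. -/
def titsSlope {X : Type*} [MetricSpace X] (μ : Measure (IdealBoundary X)) (η : IdealBoundary X) : ℝ :=
  -∫ ξ, Real.cos (titsAngle ξ η) ∂μ

/-- A measure on the Tits boundary is semistable if its slope function is nonnegative. -/
def IsSemistable {X : Type*} [MetricSpace X] (μ : Measure (IdealBoundary X)) : Prop :=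
  ∀ η : IdealBoundary X, 0 ≤ titsSlope μ η

/-- The measure `ν` on `ℤ/n` with `ν(i) = d(x_{i-1}, x_i)` given by an `n`-gon `x : ℤ/n → X`. -/
def sideMeasure {X : Type*} [MetricSpace X] {n : ℕ} [NeZero n] (x : ZMod n → X) :
    Measure (ZMod n) :=
  ∑ i : ZMod n, ENNReal.ofReal (dist (x (i - 1)) (x i)) • Measure.dirac i

/-- `ψ` is a Gauss map of the polygon `x`: a ray from `x_{i-1}` asymptotic to `ψ i` passes
through `x_i`. -/
def IsGaussMap {X : Type*} [MetricSpace X] {n : ℕ} (x : ZMod n → X)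
    (ψ : ZMod n → IdealBoundary X) : Prop :=
  ∀ i : ZMod n, ∃ ρ : GeodesicRay X,
    ρ.toFun 0 = x (i - 1) ∧ ρ.endpoint = ψ i ∧ x i ∈ Set.range ρ.toFun

/-- The slope function of `ψ_* ν` is given by the expected finite sum. -/
theorem titsSlope_map_sideMeasure {X : Type*} [MetricSpace X] {n : ℕ} [NeZero n] (x : ZMod n → X)
    (ψ : ZMod n → IdealBoundary X) (η : IdealBoundary X) :
    titsSlope ((sideMeasure x).map ψ) η =
      -∑ i : ZMod n, dist (x (i - 1)) (x i) * Real.cos (titsAngle (ψ i) η) := by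
  have hψ : Measurable ψ := measurable_from_top
  have hm : ∀ g : IdealBoundary X → ℝ, Measurable g := fun g => measurable_from_top
  unfold titsSlope sideMeasure
  rw [integral_map hψ.aemeasurable (hm _).aestronglyMeasurable, integral_finsetSum_measure]
  · congr 1
    refine Finset.sum_congr rfl fun i _ => ?_
    rw [integral_smul_measure, integral_dirac, ENNReal.toReal_ofReal dist_nonneg, smul_eq_mul]
  · intro i _
    exact (integrable_dirac (by simp)).smul_measure ENNReal.ofReal_ne_top

end

/-! Only the Hadamard property matters. Fix a ray `η`. Around the closed polygon the increments of
`d(·, η(s))` sum to zero for every `s` (`sum_dist_sub_eq_zero`). Along a side of length `t` pointing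
to `ξ`, the increment is at most a quantity tending to `-t cos ∠(ξ, η)` as `s → ∞`
(`IsHadamardSpace.exists_dist_sub_le`). Summing over the sides and letting `s → ∞` bounds the slope
below by zero. Working at finite `s` avoids constructing Busemann functions. The increment estimate
is the Bruhat–Tits inequality in the triangle `ρ(0), ρ(s), η(s)`, combined with the growth rates of
its sides and `cos_titsAngle`. -/

theorem exists_euclidean_triangle {a b c : ℝ} (ha : 0 ≤ a) (hb : 0 ≤ b) (hab : a ≤ b + c)
    (hbc : b ≤ a + c) (hca : c ≤ a + b) :
    ∃ x y z : EuclideanSpace ℝ (Fin 2), dist x y = a ∧ dist x z = b ∧ dist y z = c := by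
  have hc : 0 ≤ c := by linarith
  rcases ha.eq_or_lt with rfl | ha'
  · refine ⟨!₂[0, 0], !₂[0, 0], !₂[b, 0], by simp, ?_, ?_⟩ <;>
      (rw [EuclideanSpace.dist_eq, ← sq_eq_sq₀ (Real.sqrt_nonneg _) (by assumption),
        Real.sq_sqrt (Finset.sum_nonneg fun _ _ => sq_nonneg _)]
       simp [Fin.sum_univ_two, Real.dist_eq, sq_abs]
       try nlinarith)
  -- The law of cosines gives the abscissa of the third vertex; Heron's product shows that its
  -- height is real.
  · have hu : ((a ^ 2 + b ^ 2 - c ^ 2) / (2 * a)) ^ 2 ≤ b ^ 2 := by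
      rw [div_pow, div_le_iff₀ (by positivity)]
      nlinarith [mul_nonneg (mul_nonneg (sub_nonneg.2 hab) (sub_nonneg.2 hbc))
        (mul_nonneg (sub_nonneg.2 hca) (add_nonneg (add_nonneg ha hb) hc))]
    have hv := Real.sq_sqrt (sub_nonneg.2 hu)
    have hm : (a ^ 2 + b ^ 2 - c ^ 2) / (2 * a) * a = (a ^ 2 + b ^ 2 - c ^ 2) / 2 := by
      field_simp
    generalize Real.sqrt (b ^ 2 - ((a ^ 2 + b ^ 2 - c ^ 2) / (2 * a)) ^ 2) = v at hv
    generalize (a ^ 2 + b ^ 2 - c ^ 2) / (2 * a) = u at hv hm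
    refine ⟨!₂[0, 0], !₂[a, 0], !₂[u, v], ?_, ?_, ?_⟩ <;>
      rw [EuclideanSpace.dist_eq, ← sq_eq_sq₀ (Real.sqrt_nonneg _) (by assumption),
        Real.sq_sqrt (Finset.sum_nonneg fun _ _ => sq_nonneg _)] <;>
      simp [Fin.sum_univ_two, Real.dist_eq, sq_abs] <;> nlinarith

/-- Stewart's theorem, the Euclidean equality case of the Bruhat–Tits inequality. -/
theorem dist_lineMap_sq {V : Type*} [NormedAddCommGroup V] [InnerProductSpace ℝ V]
    (x y z : V) (r : ℝ) :
    dist (AffineMap.lineMap x y r) z ^ 2 =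
      (1 - r) * dist x z ^ 2 + r * dist y z ^ 2 - r * (1 - r) * dist x y ^ 2 := by
  have h1 : AffineMap.lineMap x y r - z = (1 - r) • (x - z) + r • (y - z) := by
    rw [AffineMap.lineMap_apply_module]; module
  have h2 : x - y = (x - z) - (y - z) := by abel
  rw [dist_eq_norm, dist_eq_norm, dist_eq_norm, dist_eq_norm, h1, h2]
  generalize x - z = u
  generalize y - z = v
  rw [norm_add_sq_real, norm_sub_sq_real, norm_smul, norm_smul, mul_pow, mul_pow, real_inner_smul_left,
    real_inner_smul_right, Real.norm_eq_abs, Real.norm_eq_abs, sq_abs, sq_abs]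
  ring

theorem IsGeodesicSegment.reverse {X : Type*} [MetricSpace X] {σ : ℝ → X} {x y : X}
    (h : IsGeodesicSegment σ x y) : IsGeodesicSegment (fun s => σ (1 - s)) y x := by
  refine ⟨by simpa using h.2.1, by simpa using h.1, fun s hs t ht => ?_⟩
  rw [h.2.2 (1 - s) ⟨by linarith [hs.2], by linarith [hs.1]⟩ (1 - t)
    ⟨by linarith [ht.2], by linarith [ht.1]⟩, dist_comm y x, sub_sub_sub_cancel_left, abs_sub_comm]

theorem GeodesicRay.dist_apply {X : Type*} [MetricSpace X] (ρ : GeodesicRay X) (s t : ℝ≥0) :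
    dist (ρ.toFun s) (ρ.toFun t) = |(s : ℝ) - t| := by
  rw [ρ.isometry.dist_eq, NNReal.dist_eq]

/-- The initial piece of length `t` of a ray is a geodesic segment. -/
theorem GeodesicRay.isGeodesicSegment {X : Type*} [MetricSpace X] (ρ : GeodesicRay X) (t : ℝ≥0) :
    IsGeodesicSegment (fun r => ρ.toFun (r.toNNReal * t)) (ρ.toFun 0) (ρ.toFun t) := by
  refine ⟨by simp, by simp, fun r hr s hs => ?_⟩
  rw [ρ.dist_apply, ρ.dist_apply]
  push_cast
  rw [Real.coe_toNNReal _ hr.1, Real.coe_toNNReal _ hs.1, ← sub_mul, abs_mul, zero_sub, abs_neg]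

/-! ### Comparison inequalities and growth rates along rays -/

namespace IsHadamardSpace

variable {X : Type*} [MetricSpace X]

theorem exists_comparison_triangle (x y z : X) : ∃ x' y' z' : EuclideanSpace ℝ (Fin 2),
    dist x' y' = dist x y ∧ dist x' z' = dist x z ∧ dist y' z' = dist y z :=
  exists_euclidean_triangle dist_nonneg dist_nonneg
    (by rw [dist_comm y z]; exact dist_triangle x z y) (dist_triangle x y z)
    (by rw [dist_comm x y]; exact dist_triangle y x z)

/-- The Bruhat–Tits inequality. -/
theorem dist_sq_le (hX : IsHadamardSpace X) {x y : X} {α : ℝ → X} (hα : IsGeodesicSegment α x y)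
    (z : X) {r : ℝ} (hr : r ∈ Set.Icc (0 : ℝ) 1) :
    dist (α r) z ^ 2 ≤
      (1 - r) * dist x z ^ 2 + r * dist y z ^ 2 - r * (1 - r) * dist x y ^ 2 := by
  obtain ⟨β, hβ⟩ := hX.geodesic x z
  obtain ⟨x', y', z', hxy, hxz, hyz⟩ := exists_comparison_triangle x y z
  have h := hX.thin x y z α β hα hβ x' y' z' hxy hxz hyz r hr 1 ⟨zero_le_one, le_rfl⟩
  rw [hβ.2.1, AffineMap.lineMap_apply_one] at h
  rw [← hxy, ← hxz, ← hyz, ← dist_lineMap_sq]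
  gcongr

theorem dist_le_of_common_vertex (hX : IsHadamardSpace X) {x y z : X} {α β : ℝ → X}
    (hα : IsGeodesicSegment α x y) (hβ : IsGeodesicSegment β x z) {r : ℝ}
    (hr : r ∈ Set.Icc (0 : ℝ) 1) : dist (α r) (β r) ≤ r * dist y z := by
  obtain ⟨x', y', z', hxy, hxz, hyz⟩ := exists_comparison_triangle x y z
  refine (hX.thin x y z α β hα hβ x' y' z' hxy hxz hyz r hr r hr).trans_eq ?_
  rw [← hyz, dist_eq_norm, dist_eq_norm, AffineMap.lineMap_apply_module,
    AffineMap.lineMap_apply_module, add_sub_add_left_eq_sub, ← smul_sub, norm_smul,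
    Real.norm_eq_abs, abs_of_nonneg hr.1]

/-- Convexity of the distance between two geodesic segments. -/
theorem dist_le_convex (hX : IsHadamardSpace X) {x y z w : X} {α β : ℝ → X}
    (hα : IsGeodesicSegment α x y) (hβ : IsGeodesicSegment β z w) {r : ℝ}
    (hr : r ∈ Set.Icc (0 : ℝ) 1) :
    dist (α r) (β r) ≤ (1 - r) * dist x z + r * dist y w := by
  -- The diagonal `σ` splits the quadrilateral into two triangles, each with a common vertex.
  obtain ⟨σ, hσ⟩ := hX.geodesic x w
  have h1 := hX.dist_le_of_common_vertex hα hσ hr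
  have h2 := hX.dist_le_of_common_vertex hσ.reverse hβ.reverse (r := 1 - r)
    ⟨by linarith [hr.2], by linarith [hr.1]⟩
  rw [sub_sub_cancel] at h2
  linarith [dist_triangle (α r) (σ r) (β r)]

theorem dist_ray_le (hX : IsHadamardSpace X) (ρ₁ ρ₂ : GeodesicRay X) {s t : ℝ≥0} (hst : s ≤ t)
    (ht : 0 < t) :
    dist (ρ₁.toFun s) (ρ₂.toFun s) ≤ (1 - (s : ℝ) / t) * dist (ρ₁.toFun 0) (ρ₂.toFun 0) +
      (s : ℝ) / t * dist (ρ₁.toFun t) (ρ₂.toFun t) := by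
  have ht' : (0 : ℝ) < t := ht
  have hr : (s : ℝ) / t ∈ Set.Icc (0 : ℝ) 1 :=
    ⟨by positivity, (div_le_one ht').2 (by exact_mod_cast hst)⟩
  have h := hX.dist_le_convex (ρ₁.isGeodesicSegment t) (ρ₂.isGeodesicSegment t) hr
  have e : ((s : ℝ) / t).toNNReal * t = s := by
    rw [← NNReal.coe_div, Real.toNNReal_coe, div_mul_cancel₀ _ ht.ne']
  simpa only [e] using h

/-- By convexity the difference quotient `F` of the distance from time `0` is nondecreasing, and it
is bounded by `2`, so it converges; the correction `a / t` vanishes in the limit. -/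
theorem tendsto_divergence (hX : IsHadamardSpace X) (ρ₁ ρ₂ : GeodesicRay X) :
    Tendsto (fun t : ℝ≥0 => dist (ρ₁.toFun t) (ρ₂.toFun t) / (t : ℝ)) atTop
      (𝓝 (ρ₁.divergence ρ₂)) := by
  refine tendsto_nhds_limUnder ?_
  set a := dist (ρ₁.toFun 0) (ρ₂.toFun 0)
  let F : ℝ≥0 → ℝ := fun t => (dist (ρ₁.toFun t) (ρ₂.toFun t) - a) / (t : ℝ)
  -- Division by zero makes `F 0 = 0`, which may break monotonicity, so small times are cut off.
  have hmono : Monotone fun t : ℝ≥0 => F (max t 1) := by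
    intro s t hst
    have hst' : max s 1 ≤ max t 1 := max_le_max_right 1 hst
    have hs : (0 : ℝ≥0) < max s 1 := lt_max_of_lt_right one_pos
    change F (max s 1) ≤ F (max t 1)
    generalize max s 1 = s at *
    generalize max t 1 = t at *
    have ht := hs.trans_le hst'
    have hs' : (0 : ℝ) < s := hs
    have h := hX.dist_ray_le ρ₁ ρ₂ hst' ht
    change _ / (s : ℝ) ≤ _
    rw [div_le_iff₀ hs']
    calc _ ≤ _ := sub_le_sub_right h a
      _ = _ := by simp only [F]; ring
  have hbdd : BddAbove (Set.range fun t : ℝ≥0 => F (max t 1)) := by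
    refine ⟨2, ?_⟩
    rintro _ ⟨t, rfl⟩
    have ht : (0 : ℝ≥0) < max t 1 := lt_max_of_lt_right one_pos
    change F (max t 1) ≤ 2
    generalize max t 1 = t at *
    have ht' : (0 : ℝ) < t := ht
    change _ / (t : ℝ) ≤ _
    rw [div_le_iff₀ ht']
    have h := dist_triangle4 (ρ₁.toFun t) (ρ₁.toFun 0) (ρ₂.toFun 0) (ρ₂.toFun t)
    rw [ρ₁.dist_apply, ρ₂.dist_apply, NNReal.coe_zero, sub_zero, zero_sub, abs_neg,
      abs_of_pos ht'] at h
    linarith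
  have hF : Tendsto F atTop (𝓝 (⨆ t : ℝ≥0, F (max t 1))) := by
    refine (tendsto_atTop_ciSup hmono hbdd).congr' ?_
    filter_upwards [eventually_ge_atTop 1] with t ht
    rw [max_eq_left ht]
  have h0 : Tendsto (fun t : ℝ≥0 => a / (t : ℝ)) atTop (𝓝 0) :=
    tendsto_const_nhds.div_atTop (NNReal.tendsto_coe_atTop.2 tendsto_id)
  refine ⟨_, (hF.add h0).congr fun t => ?_⟩
  simp only [F]
  ring

/-- The distance from a point to a ray grows with unit speed. -/
theorem _root_.GeodesicRay.tendsto_dist_div (η : GeodesicRay X) (o : X) :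
    Tendsto (fun s : ℝ≥0 => dist o (η.toFun s) / (s : ℝ)) atTop (𝓝 1) := by
  have h0 : Tendsto (fun s : ℝ≥0 => dist o (η.toFun 0) / (s : ℝ)) atTop (𝓝 0) :=
    tendsto_const_nhds.div_atTop (NNReal.tendsto_coe_atTop.2 tendsto_id)
  rw [tendsto_iff_norm_sub_tendsto_zero]
  refine squeeze_zero' (Eventually.of_forall fun _ => norm_nonneg _) ?_ h0
  filter_upwards [eventually_gt_atTop 0] with s hs
  have hs' : (0 : ℝ) < s := hs
  have h := abs_dist_sub_le o (η.toFun 0) (η.toFun s)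
  rw [η.dist_apply, NNReal.coe_zero, zero_sub, abs_neg, abs_of_pos hs'] at h
  rw [Real.norm_eq_abs, div_sub_one hs'.ne', abs_div, abs_of_pos hs']
  gcongr

/-- This is `cos 2θ = 1 - 2 sin² θ`; the bounds `0 ≤ divergence ≤ 2` ensure that `arcsin` does not
truncate. -/
theorem cos_titsAngle (hX : IsHadamardSpace X) (ρ η : GeodesicRay X) :
    Real.cos (titsAngle ρ.endpoint η.endpoint) = 1 - ρ.divergence η ^ 2 / 2 := by
  have hlim := hX.tendsto_divergence ρ η
  have h0 : 0 ≤ ρ.divergence η := ge_of_tendsto' hlim fun t => by positivity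
  have h2 : ρ.divergence η ≤ 2 := by
    have h1 := (η.tendsto_dist_div (ρ.toFun 0)).const_add 1
    rw [one_add_one_eq_two] at h1
    refine le_of_tendsto_of_tendsto hlim h1 ?_
    filter_upwards [eventually_gt_atTop 0] with t ht
    have ht' : (0 : ℝ) < t := ht
    have h := dist_triangle (ρ.toFun t) (ρ.toFun 0) (η.toFun t)
    rw [ρ.dist_apply, NNReal.coe_zero, sub_zero, abs_of_pos ht'] at h
    rw [div_le_iff₀ ht', add_mul, div_mul_cancel₀ _ ht'.ne', one_mul]
    exact h
  change Real.cos (2 * Real.arcsin (ρ.divergence η / 2)) = _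
  rw [Real.cos_two_mul, Real.cos_sq', Real.sin_arcsin (by linarith) (by linarith)]
  ring

/-- An upper bound for the increment of `d(·, η(s))` along a ray `ρ`, whose limit as `s → ∞` is the
slope at infinity along `ρ` of the Busemann function of `η`. -/
theorem exists_dist_sub_le (hX : IsHadamardSpace X) (ρ η : GeodesicRay X) (t : ℝ≥0) :
    ∃ g : ℝ≥0 → ℝ,
      (∀ᶠ s in atTop, dist (ρ.toFun t) (η.toFun s) - dist (ρ.toFun 0) (η.toFun s) ≤ g s) ∧
      Tendsto g atTop (𝓝 (-(t * Real.cos (titsAngle ρ.endpoint η.endpoint)))) := by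
  have hdiv := hX.tendsto_divergence ρ η
  have hD := η.tendsto_dist_div (ρ.toFun 0)
  have h0 : Tendsto (fun s : ℝ≥0 => (t : ℝ) ^ 2 / (s : ℝ)) atTop (𝓝 0) :=
    tendsto_const_nhds.div_atTop (NNReal.tendsto_coe_atTop.2 tendsto_id)
  -- The witness `g`, read off from this limit, is the Bruhat–Tits bound with numerator and
  -- denominator divided by `s`.
  refine ⟨_, ?_, ((((((hdiv.pow 2).sub (hD.pow 2)).sub_const 1).const_mul (t : ℝ)).add h0).div
    (hD.const_mul 2) (by norm_num)).trans_eq ?_⟩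
  · filter_upwards [eventually_gt_atTop 0, eventually_ge_atTop t,
      hD.eventually (lt_mem_nhds one_pos)] with s hs hts hDs
    have hs' : (0 : ℝ) < s := hs
    have hDs' : 0 < dist (ρ.toFun 0) (η.toFun s) := (div_pos_iff_of_pos_right hs').1 hDs
    have hr : (t : ℝ) / s ∈ Set.Icc (0 : ℝ) 1 :=
      ⟨by positivity, (div_le_one hs').2 (by exact_mod_cast hts)⟩
    have h := hX.dist_sq_le (ρ.isGeodesicSegment s) (η.toFun s) hr
    have e : ((t : ℝ) / s).toNNReal * s = t := by
      rw [← NNReal.coe_div, Real.toNNReal_coe, div_mul_cancel₀ _ hs.ne']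
    simp only [e] at h
    rw [ρ.dist_apply 0 s, NNReal.coe_zero, zero_sub, abs_neg, abs_of_pos hs'] at h
    simp only [Pi.div_apply]
    generalize dist (ρ.toFun t) (η.toFun s) = d' at *
    generalize dist (ρ.toFun 0) (η.toFun s) = D at *
    generalize dist (ρ.toFun s) (η.toFun s) = d at *
    -- Linearize: `2D(d' - D) ≤ d'² - D²`, then bound `d'²` by Bruhat–Tits.
    have key : (d' - D) * (2 * D) ≤ t / s * (d ^ 2 - D ^ 2 - s ^ 2) + t ^ 2 := by
      have e2 : (1 - (t : ℝ) / s) * D ^ 2 + t / s * d ^ 2 - t / s * (1 - t / s) * s ^ 2 =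
          D ^ 2 + t / s * (d ^ 2 - D ^ 2 - s ^ 2) + t ^ 2 := by
        field_simp
        ring
      nlinarith [sq_nonneg (d' - D)]
    refine ((le_div_iff₀ (by positivity)).2 key).trans_eq ?_
    field_simp
  · congr 1
    rw [hX.cos_titsAngle]
    ring

end IsHadamardSpace

/-! ### Summation around the polygon -/

theorem sum_dist_sub_eq_zero {X : Type*} [MetricSpace X] {n : ℕ} [NeZero n] (x : ZMod n → X)
    (p : X) : ∑ i, (dist (x i) p - dist (x (i - 1)) p) = 0 := by
  rw [Finset.sum_sub_distrib, sub_eq_zero]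
  exact (Equiv.sum_comp (Equiv.subRight (1 : ZMod n)) fun i => dist (x i) p).symm

/-- Gauss maps of polygons in Hadamard spaces push the side measure to a semistable measure. -/
theorem IsHadamardSpace.isSemistable_map_sideMeasure {X : Type*} [MetricSpace X]
    (hX : IsHadamardSpace X) {n : ℕ} [NeZero n] {x : ZMod n → X} {ψ : ZMod n → IdealBoundary X}
    (hψ : IsGaussMap x ψ) : IsSemistable ((sideMeasure x).map ψ) := by
  intro η
  induction η using Quotient.inductionOn with | _ η
  change 0 ≤ titsSlope _ η.endpoint
  rw [titsSlope_map_sideMeasure, ← Finset.sum_neg_distrib]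
  have hside : ∀ i, ∃ g : ℝ≥0 → ℝ,
      (∀ᶠ s in atTop, dist (x i) (η.toFun s) - dist (x (i - 1)) (η.toFun s) ≤ g s) ∧
      Tendsto g atTop
        (𝓝 (-(dist (x (i - 1)) (x i) * Real.cos (titsAngle (ψ i) η.endpoint)))) := by
    intro i
    obtain ⟨ρ, h0, hend, t, ht⟩ := hψ i
    have hd : dist (x (i - 1)) (x i) = t := by
      rw [← h0, ← ht, ρ.dist_apply, NNReal.coe_zero, zero_sub, abs_neg, NNReal.abs_eq]
    rw [hd, ← hend, ← h0, ← ht]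
    exact hX.exists_dist_sub_le ρ η t
  choose g hle hlim using hside
  refine ge_of_tendsto (tendsto_finsetSum Finset.univ fun i _ => hlim i) ?_
  filter_upwards [eventually_all.2 hle] with s hs
  -- The zero on the left becomes the telescoping sum, compared side by side with the bounds `g i
  -- s`.
  rw [← sum_dist_sub_eq_zero x (η.toFun s)]
  exact Finset.sum_le_sum fun i _ => hs i

theorem mainTheorem7 {X : Type*} [MetricSpace X]
    (hX : IsEuclideanBuilding X ∨ IsSymmetricSpaceOfNoncompactType X)
    (n : ℕ) [NeZero n] (x : ZMod n → X) (ψ : ZMod n → IdealBoundary X) (hψ : IsGaussMap x ψ) :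
    IsSemistable ((sideMeasure x).map ψ) ∧
      ∀ η : IdealBoundary X, titsSlope ((sideMeasure x).map ψ) η =
        -∑ i : ZMod n, dist (x (i - 1)) (x i) * Real.cos (titsAngle (ψ i) η) :=
  ⟨(hX.elim And.left fun h => h.nonpos_curved).isSemistable_map_sideMeasure hψ,
    titsSlope_map_sideMeasure x ψ⟩
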